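/- **Setting.** For $n\ge 1$ write $[n]=\{1,\dots,n\}$. A *Bandit with Monotone Jumps* (BwMJ) instance with $n$ action intervals is a triple $((\mathcal A_i)_{i\in[n]},(\nu_i)_{i\in[n]},\ell)$ such that: there are points $0=\overline\alpha_1<\dots<\overline\alpha_{n+1}=1$ with $\mathcal A_i=[\overline\alpha_i,\overline\alpha_{i+1})$ for $i<n$ and $\mathcal A_n=[\overline\alpha_n,1]$; each $\nu_i$ is a probability distribution on $[0,1]$ with mean $\mu_i$, and $\mu_1<\dots<\mu_n$; and $\ell:[0,1]\to[0,1]$ is a strictly decreasing affine function. Let $h(\alpha)$ be the index with $\alpha\in\mathcal A_{h(\alpha)}$, $u(\alpha)=\ell(\alpha)\,\mu_{h(\alpha)}$ and $\mathrm{OPT}=\max_{\alpha\in[0,1]}u(\alpha)$. A (deterministic) policy over $T$ rounds is a tuple $\pi=(\pi_t)_{t\in[T]}$, where $\pi_t$ is a measurable map from histories $(\alpha_1,x_1,\dots,\alpha_{t-1},x_{t-1})\in([0,1]^2)^{t-1}$ to $[0,1]$. In round $t$ the learner plays $\alpha_t=\pi_t(\alpha_1,x_1,\dots,\alpha_{t-1},x_{t-1})$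 and then observes $x_t$, drawn from $\nu_{h(\alpha_t)}$ conditionally on the past. The (pseudo-)regret of $\pi$ is $$R_T(\pi)=T\cdot\mathrm{OPT}-\mathbb E\Big[\sum_{t=1}^T u(\alpha_t)\Big].$$ A *hidden-action principal-agent problem* with $n$ agent's actions and $m$ outcomes consists of rewards $r_j\in[0,1]$ ($j\in[m]$), costs $c_i\in[0,1]$ ($i\in[n]$) with $c_1=0$, and probability distributions $F_i$ on $[m]$ ($i\in[n]$). Put $R_i=\mathbb E_{j\sim F_i}[r_j]$. Under the linear contract $\rho\in[0,1]$, action $i$ gives the agent expected utility $\rho R_i-c_i$ and the principal $(1-\rho)R_i$; the agent plays a best response $i^\star(\rho)\in[n]$, that is, a maximizer of the agent's expected utility, with ties broken in favor of the principal. It is assumed that $R_1<\dots<R_n$ and that for every $i\in[n]$ there is $\rho\in[0,1]$ with $\rho R_i-c_i>\rho R_j-c_j$ for all $j\ne i$. A BwMJ instance *encodes* such a problem if $\mathcal A_i=\{\rho\in[0,1]: i^\star(\rho)=i\}$ for all $i\in[n]$, $\nu_i$ is the law of $r_j$ for $j\sim F_i$, and $\ell(\rho)=1-\rho$. **Theorem.**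 There is an absolute constant $C>0$ such that the following holds for all positive integers $n,T$ with $3\le n\le T^{1/3}$. For every policy $\pi$ over $T$ rounds there is a BwMJ instance with $n$ action intervals, encoding a hidden-action principal-agent problem in which the agent has $n$ actions, on which the regret of $\pi$ satisfies $$R_T(\pi)\ \ge\ C\sqrt{nT}.$$ -/

import Mathlib

open MeasureTheory

/-- An instance of *Bandit with Monotone Jumps* with `n` action intervals. -/
structure BwMJ (n : ℕ) where
  /-- the end points of the action intervals; `bp i.castSucc` and `bp i.succ` are those of the
  `i`-th interval -/
  bp : Fin (n + 1) → unitInterval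
  bp_zero : bp 0 = 0
  bp_last : bp (Fin.last n) = 1
  bp_strictMono : StrictMono bp
  /-- the feedback distributions -/
  ν : Fin n → Measure unitInterval
  isProbabilityMeasure_ν : ∀ i, IsProbabilityMeasure (ν i)
  mean_strictMono : StrictMono fun i => ∫ x, (x : ℝ) ∂(ν i)
  /-- the linear (that is, affine) function known to the learner -/
  ℓ : unitInterval → unitInterval
  ℓ_linear : ∃ a b : ℝ, ∀ α, (ℓ α : ℝ) = a * (α : ℝ) + b
  ℓ_strictAnti : StrictAnti ℓ

namespace BwMJ

variable {n : ℕ} (B : BwMJ n)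

/-- The `i`-th action interval: closed on the left, open on the right except for the last one. -/
def interval (i : Fin n) : Set unitInterval :=
  if (i : ℕ) + 1 = n then Set.Icc (B.bp i.castSucc) (B.bp i.succ)
  else Set.Ico (B.bp i.castSucc) (B.bp i.succ)

theorem exists_mem_interval (α : unitInterval) : ∃ i, α ∈ B.interval i := by
  have hn : 0 < n := by
    rcases Nat.eq_zero_or_pos n with rfl | h
    · have h0 := B.bp_zero
      have h1 := B.bp_last
      have : (0 : unitInterval) = 1 := h0.symm.trans h1
      exact absurd this zero_ne_one
    · exact h
  let s : Finset (Fin n) := Finset.univ.filter fun i => B.bp i.castSucc ≤ α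
  have hs : s.Nonempty := ⟨⟨0, hn⟩, by
    simp only [s, Finset.mem_filter, Finset.mem_univ, true_and]
    have : (⟨0, hn⟩ : Fin n).castSucc = 0 := rfl
    rw [this, B.bp_zero]
    exact unitInterval.nonneg'⟩
  obtain ⟨i, his, hi⟩ := s.exists_maximal hs
  have hiα : B.bp i.castSucc ≤ α := (Finset.mem_filter.1 his).2
  refine ⟨i, ?_⟩
  unfold interval
  split_ifs with h
  · refine ⟨hiα, ?_⟩
    have : i.succ = Fin.last n := Fin.ext (by simpa using h)
    rw [this, B.bp_last]
    exact unitInterval.le_one'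
  · refine ⟨hiα, ?_⟩
    by_contra hlt
    have hle := not_lt.1 hlt
    have hi1 : (i : ℕ) + 1 < n := by have := i.isLt; omega
    have hmem : (⟨i + 1, hi1⟩ : Fin n) ∈ s := Finset.mem_filter.2 ⟨Finset.mem_univ _, hle⟩
    have h2 := hi hmem (Fin.le_def.2 (by simp))
    have h3 := Fin.le_def.1 h2
    simp at h3

/-- The index of the interval that contains `α`. -/
noncomputable def h (α : unitInterval) : Fin n := (B.exists_mem_interval α).choose

/-- The expected value of the feedback in the `i`-th interval. -/
noncomputable def mean (i : Fin n) : ℝ := ∫ x, (x : ℝ) ∂(B.ν i)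

/-- The learner's expected reward for the action `α`. -/
noncomputable def u (α : unitInterval) : ℝ := (B.ℓ α : ℝ) * B.mean (B.h α)

/-- The expected reward of an action that is optimal in hindsight. -/
noncomputable def OPT : ℝ := sSup (Set.range B.u)

end BwMJ

/-- A history of `t` rounds: the pairs (action, feedback) of these rounds, in order. -/
abbrev History (t : ℕ) : Type := Fin t → unitInterval × unitInterval

/-- A (deterministic) policy over `T` rounds: in round `t`, it maps the history of the preceding
rounds to an action. -/
structure Policy (T : ℕ) where
  act : ∀ t : Fin T, History t → unitInterval
  measurable_act : ∀ t, Measurable (act t)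

namespace BwMJ

variable {n T : ℕ}

/-- The law of the history of the first `t` rounds when the policy `π` interacts with the
instance `B`: given the history `H` so far, the action is `α = π_t(H)` and the feedback is sampled
from `ν_{h(α)}`. -/
noncomputable def historyLaw (B : BwMJ n) (π : Policy T) : (t : ℕ) → t ≤ T → Measure (History t)
  | 0, _ => Measure.dirac Fin.elim0
  | t + 1, ht =>
      (historyLaw B π t (Nat.le_of_succ_le ht)).bind fun H =>
        (B.ν (B.h (π.act ⟨t, ht⟩ H))).map fun x =>
          (Fin.snoc H (π.act ⟨t, ht⟩ H, x) : History (t + 1))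

/-- The cumulative pseudo-regret over `T` rounds. -/
noncomputable def regret (B : BwMJ n) (π : Policy T) : ℝ :=
  (T : ℝ) * B.OPT - ∫ H, (∑ t : Fin T, B.u (H t).1) ∂(B.historyLaw π T le_rfl)

end BwMJ

/-- A hidden-action principal-agent problem with `n` agent's actions and `m` outcomes. -/
structure PrincipalAgent (n m : ℕ) where
  /-- the principal's rewards -/
  r : Fin m → unitInterval
  /-- the agent's costs -/
  c : Fin n → unitInterval
  /-- the distributions over outcomes -/
  F : Fin n → PMF (Fin m)
  /-- the first action is costless -/
  c_first : ∀ i : Fin n, (i : ℕ) = 0 → c i = 0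

namespace PrincipalAgent

variable {n m : ℕ} (P : PrincipalAgent n m)

/-- The principal's expected reward when the agent plays `i`. -/
noncomputable def R (i : Fin n) : ℝ := ∑ j, (P.F i j).toReal * (P.r j : ℝ)

/-- The agent's expected utility for the action `i` under the linear contract `ρ`. -/
noncomputable def agentUtility (ρ : unitInterval) (i : Fin n) : ℝ := (ρ : ℝ) * P.R i - (P.c i : ℝ)

/-- The principal's expected utility for the agent's action `i` under the linear contract `ρ`. -/
noncomputable def principalUtility (ρ : unitInterval) (i : Fin n) : ℝ := (1 - (ρ : ℝ)) * P.R i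

/-- `i` is a best response to `ρ`, ties being broken in favor of the principal. -/
def IsBestResponse (ρ : unitInterval) (i : Fin n) : Prop :=
  (∀ j, P.agentUtility ρ j ≤ P.agentUtility ρ i) ∧
    ∀ j, (∀ k, P.agentUtility ρ k ≤ P.agentUtility ρ j) →
      P.principalUtility ρ j ≤ P.principalUtility ρ i

/-- The standing assumptions: the actions are ordered by increasing expected reward, and each of
them is the unique best action for the agent under some linear contract. -/
structure Standing : Prop where
  R_strictMono : StrictMono P.R
  implementable : ∀ i, ∃ ρ : unitInterval, ∀ j, j ≠ i → P.agentUtility ρ j < P.agentUtility ρ i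

end PrincipalAgent

/-- The instance `B` encodes the principal-agent problem `P`: its intervals are the best-response
regions, its feedback in the `i`-th interval is the principal's reward for an outcome drawn from
`F_i`, and `ℓ(ρ) = 1 - ρ`. -/
structure BwMJ.Encodes {n m : ℕ} (B : BwMJ n) (P : PrincipalAgent n m) : Prop where
  interval_eq : ∀ i, B.interval i = {ρ | P.IsBestResponse ρ i}
  ν_eq : ∀ i, B.ν i = (P.F i).toMeasure.map P.r
  ℓ_eq : ∀ ρ : unitInterval, (B.ℓ ρ : ℝ) = 1 - (ρ : ℝ)

open ProbabilityTheory

/-! ### Action intervals and play counts. -/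

namespace BwMJ

variable {n T : ℕ}

/-! A needle-in-a-haystack argument. The means `baseMean n i` increase by `1 / (4 n)` per interval,
and the break points are chosen so that the left end point of every interval has expected reward
exactly `1 / 4`. Raising the `k`-th mean by `ε ≤ 1 / (8 n)` keeps the means increasing and the
intervals unchanged, and makes every round played outside interval `k` cost at least `ε / 2`
(`le_regret_perturbedData`).

On the unperturbed instance some interval `k` is played at most `T / n` times in expectation
(`exists_integral_count_le`). Perturbing that interval is hard to notice: the relative entropy
between the two history laws is at most `K = O(ε²)` times this expected count. The Donsker–Varadhan
inequality then bounds the count after the perturbation (`integral_count_le`). Relative entropy of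
histories is never formed: the inequality is proved for Bernoulli laws (`exp_le_bernoulli_mixture`)
and propagated round by round (`exp_integral_le_integral_exp`). With `ε` of order `√(n / T)`, a
constant fraction of the rounds stays outside interval `k`, so the regret is of order `ε T = √(n
T)`; `n ≤ T^(1/3)` is what makes this `ε` at most `1 / (8 n)`.

Any such step data come from a principal-agent problem with two outcomes, once the costs are chosen
so that consecutive actions tie at the break points (`bandit_encodes`). -/

theorem h_mem (B : BwMJ n) (α : unitInterval) : α ∈ B.interval (B.h α) :=
  (B.exists_mem_interval α).choose_spec

theorem interval_subset_Icc (B : BwMJ n) (i : Fin n) :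
    B.interval i ⊆ Set.Icc (B.bp i.castSucc) (B.bp i.succ) := by
  unfold interval
  split_ifs
  · exact le_rfl
  · exact Set.Ico_subset_Icc_self

theorem lt_of_mem_interval (B : BwMJ n) {α : unitInterval} {i j : Fin n} (hij : i < j)
    (hα : α ∈ B.interval i) : α < B.bp i.succ := by
  unfold interval at hα
  split_ifs at hα with hi
  · have := Fin.lt_def.1 hij
    omega
  · exact hα.2

theorem h_eq_of_mem (B : BwMJ n) {α : unitInterval} {i : Fin n} (hα : α ∈ B.interval i) :
    B.h α = i := by
  have key : ∀ j k : Fin n, j < k → α ∈ B.interval j → α ∉ B.interval k := fun j k hjk hj hk =>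
    absurd (B.lt_of_mem_interval hjk hj) (not_lt.2
      ((B.bp_strictMono.monotone (Fin.le_def.2 (by simpa using Fin.lt_def.1 hjk))).trans
        (B.interval_subset_Icc k hk).1))
  rcases lt_trichotomy (B.h α) i with hlt | heq | hlt
  · exact absurd hα (key _ _ hlt (B.h_mem α))
  · exact heq
  · exact absurd (B.h_mem α) (key _ _ hlt hα)

/-- Lets play counts be compared between instances that differ only in their feedback. -/
theorem h_eq_h_of_bp_eq {B B' : BwMJ n} (hbp : B.bp = B'.bp) : B.h = B'.h := by
  funext α
  refine B.h_eq_of_mem ?_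
  have := B'.h_mem α
  unfold interval at this ⊢
  rwa [hbp]

theorem measurable_h (B : BwMJ n) : Measurable B.h := by
  refine measurable_to_countable' fun i => ?_
  have : B.h ⁻¹' {i} = B.interval i := by
    ext α
    exact ⟨fun hα => by rw [← Set.mem_singleton_iff.1 hα]; exact B.h_mem α, B.h_eq_of_mem⟩
  rw [this]
  unfold interval
  split_ifs
  · exact measurableSet_Icc
  · exact measurableSet_Ico

/-- The number of rounds of a history in which the action lies in the `k`-th interval. -/
noncomputable def count (B : BwMJ n) (k : Fin n) {t : ℕ} (H : History t) : ℝ :=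
  ∑ s : Fin t, if B.h (H s).1 = k then 1 else 0

theorem count_nonneg (B : BwMJ n) (k : Fin n) {t : ℕ} (H : History t) : 0 ≤ B.count k H :=
  Finset.sum_nonneg fun s _ => by split_ifs <;> norm_num

theorem count_le (B : BwMJ n) (k : Fin n) {t : ℕ} (H : History t) : B.count k H ≤ t := by
  calc B.count k H ≤ ∑ _s : Fin t, (1 : ℝ) :=
        Finset.sum_le_sum fun s _ => by split_ifs <;> norm_num
    _ = t := by simp

theorem sum_count (B : BwMJ n) {t : ℕ} (H : History t) : ∑ k, B.count k H = t := by
  unfold count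
  rw [Finset.sum_comm]
  simp

theorem count_snoc (B : BwMJ n) (k : Fin n) {t : ℕ} (H : History t)
    (z : unitInterval × unitInterval) :
    B.count k (Fin.snoc H z : History (t + 1)) =
      B.count k H + if B.h z.1 = k then 1 else 0 := by
  unfold count
  rw [Fin.sum_univ_castSucc]
  simp [Fin.snoc_castSucc, Fin.snoc_last]

theorem measurable_count (B : BwMJ n) (k : Fin n) (t : ℕ) :
    Measurable (B.count k : History t → ℝ) := by
  refine Finset.measurable_sum _ fun s _ => ?_
  exact Measurable.ite ((B.measurable_h.comp (measurable_fst.comp (measurable_pi_apply s)))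
    (measurableSet_singleton k)) measurable_const measurable_const

/-! ### History laws under Bernoulli feedback. -/

/-- The feedback of `B` is Bernoulli with parameters `p`. -/
def IsBernoulli (B : BwMJ n) (p : Fin n → unitInterval) : Prop :=
  ∀ i, B.ν i = bernoulliMeasure 1 0 (p i)

theorem IsBernoulli.mean_eq {B : BwMJ n} {p : Fin n → unitInterval} (hB : B.IsBernoulli p)
    (i : Fin n) : B.mean i = p i := by
  unfold mean
  rw [hB i, integral_bernoulliMeasure]
  simp

/-- The conditional expectation of `g` one round ahead, given the history so far, when the next
action is given by `a` and the feedback is Bernoulli with parameters `p`. -/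
noncomputable def lookahead (B : BwMJ n) (p : Fin n → unitInterval) {t : ℕ}
    (a : History t → unitInterval) (g : History (t + 1) → ℝ) (H : History t) : ℝ :=
  (p (B.h (a H)) : ℝ) * g (Fin.snoc H (a H, 1)) +
    (1 - (p (B.h (a H)) : ℝ)) * g (Fin.snoc H (a H, 0))

theorem measurable_snoc {t : ℕ} {a : History t → unitInterval} (ha : Measurable a)
    (x : unitInterval) :
    Measurable fun H : History t => (Fin.snoc H (a H, x) : History (t + 1)) := by
  refine measurable_pi_iff.2 fun s => ?_
  refine Fin.lastCases ?_ (fun s => ?_) s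
  · simpa using ha.prodMk measurable_const
  · simpa using measurable_pi_apply s

theorem measurable_lookahead (B : BwMJ n) (p : Fin n → unitInterval) {t : ℕ}
    {a : History t → unitInterval} (ha : Measurable a) {g : History (t + 1) → ℝ}
    (hg : Measurable g) : Measurable (B.lookahead p a g) := by
  have hp : Measurable fun H => (p (B.h (a H)) : ℝ) :=
    (measurable_of_countable fun i => (p i : ℝ)).comp (B.measurable_h.comp ha)
  exact (hp.mul (hg.comp (measurable_snoc ha 1))).add
    ((measurable_const.sub hp).mul (hg.comp (measurable_snoc ha 0)))

theorem abs_lookahead_le (B : BwMJ n) (p : Fin n → unitInterval) {t : ℕ}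
    (a : History t → unitInterval) {g : History (t + 1) → ℝ} {M : ℝ} (hM : ∀ H, |g H| ≤ M)
    (H : History t) : |B.lookahead p a g H| ≤ M := by
  unfold lookahead
  have h0 := unitInterval.nonneg (p (B.h (a H)))
  have h1 := unitInterval.le_one (p (B.h (a H)))
  have hx := abs_le.1 (hM (Fin.snoc H (a H, 1)))
  have hy := abs_le.1 (hM (Fin.snoc H (a H, 0)))
  rw [abs_le]
  constructor <;> nlinarith

/-- The transition kernel of the history when the feedback is Bernoulli. -/
noncomputable def stepKernel (B : BwMJ n) (p : Fin n → unitInterval) {t : ℕ}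
    (a : History t → unitInterval) (ha : Measurable a) : Kernel (History t) (History (t + 1)) where
  toFun H := bernoulliMeasure (Fin.snoc H (a H, 1)) (Fin.snoc H (a H, 0)) (p (B.h (a H)))
  measurable' := by
    refine Measure.measurable_of_measurable_coe _ fun s hs => ?_
    have hdirac : ∀ x : unitInterval, Measurable fun H : History t =>
        Measure.dirac (Fin.snoc H (a H, x) : History (t + 1)) s := fun x =>
      (Measure.measurable_coe hs).comp (Measure.measurable_dirac.comp (measurable_snoc ha x))
    have hp : ∀ f : unitInterval → ENNReal, Measurable fun H : History t => f (p (B.h (a H))) :=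
      fun f => (measurable_of_countable fun i => f (p i)).comp (B.measurable_h.comp ha)
    simp only [bernoulliMeasure_def, Measure.coe_add, Pi.add_apply, Measure.smul_apply,
      ENNReal.smul_def, smul_eq_mul]
    exact ((hp fun q => (unitInterval.toNNReal q : ENNReal)).mul (hdirac 1)).add
      ((hp fun q => (unitInterval.toNNReal (unitInterval.symm q) : ENNReal)).mul (hdirac 0))

theorem stepKernel_apply (B : BwMJ n) (p : Fin n → unitInterval) {t : ℕ}
    (a : History t → unitInterval) (ha : Measurable a) (H : History t) :
    B.stepKernel p a ha H = bernoulliMeasure (Fin.snoc H (a H, 1) : History (t + 1))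
      (Fin.snoc H (a H, 0)) (p (B.h (a H))) := rfl

instance (B : BwMJ n) (p : Fin n → unitInterval) {t : ℕ} (a : History t → unitInterval)
    (ha : Measurable a) : IsMarkovKernel (B.stepKernel p a ha) :=
  ⟨fun H => by rw [stepKernel_apply]; infer_instance⟩

/-- Writing the step as a kernel supplies the measurability needed to integrate against `bind`. -/
theorem IsBernoulli.historyLaw_succ {B : BwMJ n} {p : Fin n → unitInterval}
    (hB : B.IsBernoulli p) (π : Policy T) (t : ℕ) (ht : t + 1 ≤ T) :
    B.historyLaw π (t + 1) ht = (B.historyLaw π t (Nat.le_of_succ_le ht)).bind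
      (B.stepKernel p (π.act ⟨t, ht⟩) (π.measurable_act ⟨t, ht⟩)) := by
  rw [historyLaw]
  congr 1
  funext H
  rw [hB, map_bernoulliMeasure]
  rfl

theorem IsBernoulli.isProbabilityMeasure_historyLaw {B : BwMJ n} {p : Fin n → unitInterval}
    (hB : B.IsBernoulli p) (π : Policy T) :
    ∀ (t : ℕ) (ht : t ≤ T), IsProbabilityMeasure (B.historyLaw π t ht)
  | 0, _ => by rw [historyLaw]; infer_instance
  | t + 1, ht => by
    have := hB.isProbabilityMeasure_historyLaw π t (Nat.le_of_succ_le ht)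
    rw [hB.historyLaw_succ π t ht]
    infer_instance

theorem integrable_of_abs_le {α : Type*} [MeasurableSpace α] (μ : Measure α) [IsFiniteMeasure μ]
    {g : α → ℝ} (hg : Measurable g) {M : ℝ} (hM : ∀ x, |g x| ≤ M) : Integrable g μ :=
  Integrable.of_bound hg.aestronglyMeasurable M (ae_of_all _ hM)

theorem IsBernoulli.integral_historyLaw_succ {B : BwMJ n} {p : Fin n → unitInterval}
    (hB : B.IsBernoulli p) (π : Policy T) (t : ℕ) (ht : t + 1 ≤ T) {g : History (t + 1) → ℝ}
    (hg : Measurable g) {M : ℝ} (hM : ∀ H, |g H| ≤ M) :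
    ∫ H, g H ∂(B.historyLaw π (t + 1) ht) =
      ∫ H, B.lookahead p (π.act ⟨t, ht⟩) g H ∂(B.historyLaw π t (Nat.le_of_succ_le ht)) := by
  have := hB.isProbabilityMeasure_historyLaw π t (Nat.le_of_succ_le ht)
  rw [hB.historyLaw_succ π t ht, Measure.comp_eq_comp_const_apply,
    Kernel.integral_comp (integrable_of_abs_le _ hg hM)]
  simp only [Kernel.const_apply]
  refine integral_congr_ae (ae_of_all _ fun H => ?_)
  exact (integral_bernoulliMeasure _ _ _ _).trans (by simp [lookahead])

/-! ### Change of measure. -/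

/-- Donsker–Varadhan for two Bernoulli laws, with the relative entropy replaced by the larger χ²
divergence. -/
theorem exp_le_bernoulli_mixture {p q : ℝ} (hp : 0 < p) (hp1 : p < 1) (hq : 0 < q) (hq1 : q < 1)
    (x y : ℝ) :
    Real.exp (p * x + (1 - p) * y - (p - q) ^ 2 / (q * (1 - q))) ≤
      q * Real.exp x + (1 - q) * Real.exp y := by
  have hp' : 0 < 1 - p := by linarith
  have hq' : 0 < 1 - q := by linarith
  -- Jensen under the law `p`, with the log-likelihood ratio added to the exponent so that the
  -- right-hand side becomes the mean under `q`.
  have hjensen := convexOn_exp.2 (Set.mem_univ (x + Real.log (q / p)))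
    (Set.mem_univ (y + Real.log ((1 - q) / (1 - p)))) hp.le hp'.le (by ring)
  rw [Real.exp_add x, Real.exp_add y, Real.exp_log (div_pos hq hp),
    Real.exp_log (div_pos hq' hp')] at hjensen
  simp only [smul_eq_mul] at hjensen
  have e1 : p * (Real.exp x * (q / p)) + (1 - p) * (Real.exp y * ((1 - q) / (1 - p))) =
      q * Real.exp x + (1 - q) * Real.exp y := by
    field_simp
  rw [e1] at hjensen
  refine le_trans (Real.exp_le_exp.2 ?_) hjensen
  -- `log z ≤ z - 1` at the two likelihood ratios bounds the relative entropy by χ².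
  have l1 := Real.log_le_sub_one_of_pos (div_pos hp hq)
  have l2 := Real.log_le_sub_one_of_pos (div_pos hp' hq')
  rw [← inv_div q p, Real.log_inv] at l1
  rw [← inv_div (1 - q) (1 - p), Real.log_inv] at l2
  rw [inv_div] at l1 l2
  have m1 := mul_le_mul_of_nonneg_left l1 hp.le
  have m2 := mul_le_mul_of_nonneg_left l2 hp'.le
  have e2 : (p - q) ^ 2 / (q * (1 - q)) =
      p * (p / q - 1) + (1 - p) * ((1 - p) / (1 - q) - 1) := by
    field_simp
    ring
  rw [e2]
  linarith

/-- Donsker–Varadhan for histories. Only rounds in interval `k` distinguish the instances, and each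
contributes at most `K`. The induction peels off the last round, so `g` has to be arbitrary. -/
theorem exp_integral_le_integral_exp {B B' : BwMJ n} (hbp : B.bp = B'.bp)
    {p p' : Fin n → unitInterval} (hB : B.IsBernoulli p) (hB' : B'.IsBernoulli p') {k : Fin n}
    (hpp : ∀ i, i ≠ k → p' i = p i) (hk : 0 < (p k : ℝ)) (hk1 : (p k : ℝ) < 1)
    (hk' : 0 < (p' k : ℝ)) (hk1' : (p' k : ℝ) < 1) {K : ℝ} (hK0 : 0 ≤ K)
    (hK : ((p k : ℝ) - p' k) ^ 2 / (p' k * (1 - p' k)) ≤ K) (π : Policy T) :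
    ∀ (t : ℕ) (ht : t ≤ T) (g : History t → ℝ), Measurable g → ∀ M : ℝ, (∀ H, |g H| ≤ M) →
      Real.exp (∫ H, (g H - K * B.count k H) ∂(B.historyLaw π t ht)) ≤
        ∫ H, Real.exp (g H) ∂(B'.historyLaw π t ht)
  | 0, ht, g, hg, M, hM => by
    simp only [historyLaw]
    rw [integral_dirac, integral_dirac]
    simp [count]
  | t + 1, ht, g, hg, M, hM => by
    have iP := hB'.isProbabilityMeasure_historyLaw π t (Nat.le_of_succ_le ht)
    have hh : B'.h = B.h := h_eq_h_of_bp_eq hbp.symm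
    set a := π.act ⟨t, ht⟩ with ha_def
    have ha : Measurable a := π.measurable_act ⟨t, ht⟩
    have hexpM : ∀ H, |Real.exp (g H)| ≤ Real.exp M := fun H => by
      rw [Real.abs_exp]
      exact Real.exp_le_exp.2 (abs_le.1 (hM H)).2
    have hind : Measurable fun H : History t => if B.h (a H) = k then (1 : ℝ) else 0 :=
      Measurable.ite ((B.measurable_h.comp ha) (measurableSet_singleton k)) measurable_const
        measurable_const
    -- The last round is averaged out under `B` and its information cost charged; the induction
    -- hypothesis is applied to the result.
    let g' : History t → ℝ := fun H =>
      B.lookahead p a g H - K * if B.h (a H) = k then 1 else 0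
    have hg' : Measurable g' := (B.measurable_lookahead p ha hg).sub (hind.const_mul K)
    have hM' : ∀ H, |g' H| ≤ M + K := fun H => by
      have := abs_le.1 (B.abs_lookahead_le p a hM H)
      simp only [g']
      rw [abs_le]
      split_ifs <;> constructor <;> linarith
    have ih := exp_integral_le_integral_exp hbp hB hB' hpp hk hk1 hk' hk1' hK0 hK π t
      (Nat.le_of_succ_le ht) g' hg' (M + K) hM'
    have hbound : ∀ H : History (t + 1), |g H - K * B.count k H| ≤ M + K * (t + 1 : ℕ) := by
      intro H
      have h1 := abs_le.1 (hM H)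
      have h2 := mul_le_mul_of_nonneg_left (B.count_le k H) hK0
      have h3 := mul_nonneg hK0 (B.count_nonneg k H)
      rw [abs_le]
      constructor <;> linarith
    rw [hB.integral_historyLaw_succ π t ht (g := fun H => g H - K * B.count k H) (hg.sub ((B.measurable_count k _).const_mul K)) hbound,
      hB'.integral_historyLaw_succ π t ht hg.exp hexpM]
    have hleft : ∀ H, B.lookahead p a (fun H => g H - K * B.count k H) H =
        g' H - K * B.count k H := fun H => by
      simp only [g', lookahead, count_snoc]
      ring
    have hright : ∀ H, Real.exp (g' H) ≤ B'.lookahead p' a (fun H => Real.exp (g H)) H := by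
      intro H
      simp only [g', lookahead, hh]
      by_cases hc : B.h (a H) = k
      · rw [if_pos hc, hc, mul_one]
        refine le_trans (Real.exp_le_exp.2 ?_) (exp_le_bernoulli_mixture hk hk1 hk' hk1' _ _)
        linarith
      -- Outside interval `k` the feedback laws agree, so plain Jensen suffices at no cost.
      · rw [if_neg hc, hpp _ hc, mul_zero, sub_zero]
        exact convexOn_exp.2 (Set.mem_univ _) (Set.mem_univ _) (unitInterval.nonneg _)
          (sub_nonneg.2 (unitInterval.le_one _)) (by ring)
    simp only [← ha_def, hleft]
    refine ih.trans (integral_mono ?_ ?_ hright)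
    · refine integrable_of_abs_le _ hg'.exp (M := Real.exp (M + K)) fun H => ?_
      rw [Real.abs_exp]
      exact Real.exp_le_exp.2 (abs_le.1 (hM' H)).2
    · exact integrable_of_abs_le _ (B'.measurable_lookahead p' ha hg.exp)
        (B'.abs_lookahead_le p' a hexpM)

end BwMJ

/-! ### Step data and their principal-agent problems. -/

/-- The data of a Bernoulli instance with `n` intervals: `a 0, …, a n` are the end points of the
intervals and `R 0, …, R (n - 1)` the means. -/
structure StepData (n : ℕ) where
  a : ℕ → ℝ
  R : ℕ → ℝ
  a_zero : a 0 = 0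
  a_last : a n = 1
  a_strictMonoOn : StrictMonoOn a (Set.Iic n)
  R_strictMono : StrictMono R
  R_mem : ∀ i < n, R i ∈ Set.Icc (0 : ℝ) 1

namespace StepData

variable {n : ℕ} (S : StepData n)

theorem a_mem {i : ℕ} (hi : i ≤ n) : S.a i ∈ Set.Icc (0 : ℝ) 1 := by
  rw [← S.a_zero, ← S.a_last]
  exact ⟨S.a_strictMonoOn.monotoneOn (Set.mem_Iic.2 (Nat.zero_le n)) hi (Nat.zero_le i),
    S.a_strictMonoOn.monotoneOn hi (Set.mem_Iic.2 le_rfl) hi⟩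

/-- The costs for which the agent switches from the action `i` to the action `i + 1` at
`a (i + 1)`. -/
noncomputable def cost (i : ℕ) : ℝ := ∑ j ∈ Finset.range i, S.a (j + 1) * (S.R (j + 1) - S.R j)

/-- The cost difference is a sum of increments of `R` weighted by break points up to `a j`, the
largest. With `le_cost_sub`, this reduces comparing distant actions to the position of `ρ` relative
to one break point. -/
theorem cost_sub_le {i j : ℕ} (hij : i ≤ j) (hj : j ≤ n) :
    S.cost j - S.cost i ≤ S.a j * (S.R j - S.R i) := by
  induction j, hij using Nat.le_induction with
  | base => simp
  | succ j hij ih =>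
    have h1 := ih (by omega)
    have h2 : S.cost (j + 1) = S.cost j + S.a (j + 1) * (S.R (j + 1) - S.R j) :=
      Finset.sum_range_succ _ _
    have h3 : S.a j ≤ S.a (j + 1) :=
      S.a_strictMonoOn.monotoneOn (Set.mem_Iic.2 (by omega)) hj (by omega)
    have h4 := mul_le_mul_of_nonneg_right h3 (sub_nonneg.2 (S.R_strictMono.monotone hij))
    rw [h2]
    linarith

theorem le_cost_sub {i j : ℕ} (hij : i ≤ j) (hj : j ≤ n) :
    S.a (i + 1) * (S.R j - S.R i) ≤ S.cost j - S.cost i := by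
  induction j, hij using Nat.le_induction with
  | base => simp
  | succ j hij ih =>
    have h1 := ih (by omega)
    have h2 : S.cost (j + 1) = S.cost j + S.a (j + 1) * (S.R (j + 1) - S.R j) :=
      Finset.sum_range_succ _ _
    have h3 : S.a (i + 1) ≤ S.a (j + 1) :=
      S.a_strictMonoOn.monotoneOn (Set.mem_Iic.2 (by omega)) hj (by omega)
    have h4 := mul_le_mul_of_nonneg_right h3
      (sub_nonneg.2 (S.R_strictMono.monotone (Nat.le_succ j)))
    rw [h2]
    linarith

theorem cost_mem {i : ℕ} (hi : i < n) : S.cost i ∈ Set.Icc (0 : ℝ) 1 := by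
  constructor
  · refine Finset.sum_nonneg fun j hj => mul_nonneg (S.a_mem ?_).1
      (sub_nonneg.2 (S.R_strictMono.monotone (Nat.le_succ j)))
    have := Finset.mem_range.1 hj
    omega
  · have h := S.cost_sub_le (Nat.zero_le i) hi.le
    have h0 : S.cost 0 = 0 := Finset.sum_range_zero _
    have ha := S.a_mem hi.le
    have hR := S.R_mem i hi
    have hR0 := S.R_mem 0 (by omega)
    have hmono := S.R_strictMono.monotone (Nat.zero_le i)
    have : S.a i * (S.R i - S.R 0) ≤ 1 * (S.R i - S.R 0) :=
      mul_le_mul_of_nonneg_right ha.2 (sub_nonneg.2 hmono)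
    linarith [hR.2, hR0.1]

/-- The means as points of the unit interval. -/
def prob (i : Fin n) : unitInterval := ⟨S.R i, S.R_mem i i.isLt⟩

/-- The bandit instance with Bernoulli feedback given by the data. -/
noncomputable def bandit : BwMJ n where
  bp i := ⟨S.a i, S.a_mem (Nat.lt_succ_iff.1 i.isLt)⟩
  bp_zero := Subtype.ext S.a_zero
  bp_last := Subtype.ext S.a_last
  bp_strictMono i j hij := Subtype.mk_lt_mk.2 (S.a_strictMonoOn
    (Set.mem_Iic.2 (Nat.lt_succ_iff.1 i.isLt)) (Set.mem_Iic.2 (Nat.lt_succ_iff.1 j.isLt)) hij)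
  ν i := bernoulliMeasure 1 0 (S.prob i)
  isProbabilityMeasure_ν _ := inferInstance
  mean_strictMono i j hij := by
    simp only [integral_bernoulliMeasure]
    simpa [prob] using S.R_strictMono hij
  ℓ := unitInterval.symm
  ℓ_linear := ⟨-1, 1, fun α => by rw [unitInterval.coe_symm_eq]; ring⟩
  ℓ_strictAnti := unitInterval.strictAnti_symm

theorem bandit_isBernoulli : S.bandit.IsBernoulli S.prob := fun _ => rfl

/-- The principal-agent problem with the outcomes `0` and `1` given by the data. -/
noncomputable def principalAgent : PrincipalAgent n 2 where
  r := ![0, 1]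
  c i := ⟨S.cost i, S.cost_mem i.isLt⟩
  F i := (bernoulliMeasure (1 : Fin 2) 0 (S.prob i)).toPMF
  c_first i hi := Subtype.ext (by simp [cost, hi])

theorem principalAgent_R (i : Fin n) : S.principalAgent.R i = S.R i := by
  unfold PrincipalAgent.R
  rw [Fin.sum_univ_two]
  simp [principalAgent, Measure.toPMF_apply, prob]

theorem agentUtility_eq (ρ : unitInterval) (i : Fin n) :
    S.principalAgent.agentUtility ρ i = ρ * S.R i - S.cost i := by
  unfold PrincipalAgent.agentUtility
  rw [principalAgent_R]
  rfl

theorem agentUtility_lt_of_lt {ρ : unitInterval} {i j : Fin n} (hij : i < j)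
    (hρ : (ρ : ℝ) < S.a (i + 1)) :
    S.principalAgent.agentUtility ρ j < S.principalAgent.agentUtility ρ i := by
  rw [agentUtility_eq, agentUtility_eq]
  have h1 := S.le_cost_sub (Fin.le_def.1 hij.le) j.isLt.le
  have h2 := mul_lt_mul_of_pos_right hρ (sub_pos.2 (S.R_strictMono (Fin.lt_def.1 hij)))
  linarith

theorem agentUtility_lt_of_gt {ρ : unitInterval} {i j : Fin n} (hij : j < i)
    (hρ : S.a i < ρ) :
    S.principalAgent.agentUtility ρ j < S.principalAgent.agentUtility ρ i := by
  rw [agentUtility_eq, agentUtility_eq]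
  have h1 := S.cost_sub_le (Fin.le_def.1 hij.le) i.isLt.le
  have h2 := mul_lt_mul_of_pos_right hρ (sub_pos.2 (S.R_strictMono (Fin.lt_def.1 hij)))
  linarith

theorem agentUtility_le_of_gt {ρ : unitInterval} {i j : Fin n} (hij : j < i)
    (hρ : S.a i ≤ ρ) :
    S.principalAgent.agentUtility ρ j ≤ S.principalAgent.agentUtility ρ i := by
  rw [agentUtility_eq, agentUtility_eq]
  have h1 := S.cost_sub_le (Fin.le_def.1 hij.le) i.isLt.le
  have h2 := mul_le_mul_of_nonneg_right hρ (sub_pos.2 (S.R_strictMono (Fin.lt_def.1 hij))).le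
  linarith

theorem principalAgent_standing : S.principalAgent.Standing where
  R_strictMono i j hij := by
    rw [principalAgent_R, principalAgent_R]
    exact S.R_strictMono hij
  implementable i := by
    have hi : (i : ℕ) + 1 ≤ n := i.isLt
    have hlt : S.a i < S.a (i + 1) :=
      S.a_strictMonoOn (Set.mem_Iic.2 (by omega)) (Set.mem_Iic.2 hi) (Nat.lt_succ_self i)
    have h0 := (S.a_mem (i := i) (by omega)).1
    have h1 := (S.a_mem hi).2
    refine ⟨⟨(S.a i + S.a (i + 1)) / 2, by constructor <;> linarith⟩, fun j hj => ?_⟩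
    rcases lt_or_gt_of_ne hj with h | h
    · exact S.agentUtility_lt_of_gt h (show S.a i < (S.a i + S.a (i + 1)) / 2 by linarith)
    · exact S.agentUtility_lt_of_lt h (show (S.a i + S.a (i + 1)) / 2 < S.a (i + 1) by linarith)

theorem a_le_of_mem_interval {ρ : unitInterval} {i : Fin n} (hρ : ρ ∈ S.bandit.interval i) :
    S.a i ≤ ρ :=
  (S.bandit.interval_subset_Icc i hρ).1

theorem lt_a_of_mem_interval {ρ : unitInterval} {i j : Fin n} (hij : i < j)
    (hρ : ρ ∈ S.bandit.interval i) : (ρ : ℝ) < S.a (i + 1) :=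
  S.bandit.lt_of_mem_interval hij hρ

theorem isBestResponse_of_mem_interval {ρ : unitInterval} {i : Fin n}
    (hρ : ρ ∈ S.bandit.interval i) : S.principalAgent.IsBestResponse ρ i := by
  refine ⟨fun j => ?_, fun j hj => ?_⟩
  · rcases lt_trichotomy j i with h | rfl | h
    · exact S.agentUtility_le_of_gt h (S.a_le_of_mem_interval hρ)
    · exact le_rfl
    · exact (S.agentUtility_lt_of_lt h (S.lt_a_of_mem_interval h hρ)).le
  · have hji : j ≤ i := by
      by_contra! h
      exact absurd (hj i) (not_le.2 (S.agentUtility_lt_of_lt h (S.lt_a_of_mem_interval h hρ)))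
    unfold PrincipalAgent.principalUtility
    rw [principalAgent_R, principalAgent_R]
    exact mul_le_mul_of_nonneg_left (S.R_strictMono.monotone hji)
      (sub_nonneg.2 (unitInterval.le_one ρ))

theorem isBestResponse_unique {ρ : unitInterval} {i j : Fin n} (hρ : ρ ∈ S.bandit.interval i)
    (hj : S.principalAgent.IsBestResponse ρ j) : j = i := by
  rcases lt_trichotomy j i with h | h | h
  · exfalso
    have hu := hj.2 i (S.isBestResponse_of_mem_interval hρ).1
    unfold PrincipalAgent.principalUtility at hu
    rw [principalAgent_R, principalAgent_R] at hu
    have hR := S.R_strictMono (Fin.lt_def.1 h)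
    rcases (unitInterval.le_one ρ).lt_or_eq with h1 | h1
    · nlinarith
    -- At `ρ = 1` the principal earns nothing from any action, so tie-breaking does not decide; but
    -- `1` lies strictly to the right of `a i`, so the agent strictly prefers `i`.
    · have hi : S.a i < ρ := by
        rw [h1, ← S.a_last]
        exact S.a_strictMonoOn (Set.mem_Iic.2 i.isLt.le) (Set.mem_Iic.2 le_rfl) i.isLt
      exact absurd (hj.1 i) (not_le.2 (S.agentUtility_lt_of_gt h hi))
  · exact h
  · exact absurd (hj.1 i) (not_le.2 (S.agentUtility_lt_of_lt h (S.lt_a_of_mem_interval h hρ)))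

theorem bandit_encodes : S.bandit.Encodes S.principalAgent where
  interval_eq i := by
    ext ρ
    refine ⟨S.isBestResponse_of_mem_interval, fun hρ => ?_⟩
    obtain ⟨j, hj⟩ := S.bandit.exists_mem_interval ρ
    rwa [S.isBestResponse_unique hj hρ]
  ν_eq i := by
    simp only [principalAgent, Measure.toPMF_toMeasure, map_bernoulliMeasure]
    rfl
  ℓ_eq ρ := unitInterval.coe_symm_eq ρ

/-- Within an interval the mean is constant and `ℓ` decreases, so the left end point is best. -/
theorem u_le (α : unitInterval) :
    S.bandit.u α ≤ (1 - S.a (S.bandit.h α)) * S.R (S.bandit.h α) := by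
  unfold BwMJ.u
  rw [S.bandit_isBernoulli.mean_eq, S.bandit_encodes.ℓ_eq]
  exact mul_le_mul_of_nonneg_right
    (sub_le_sub_left (S.a_le_of_mem_interval (S.bandit.h_mem α)) 1) (S.R_mem _ (Fin.isLt _)).1

theorem u_nonneg (α : unitInterval) : 0 ≤ S.bandit.u α := by
  unfold BwMJ.u
  rw [S.bandit_isBernoulli.mean_eq]
  exact mul_nonneg (unitInterval.nonneg _) (unitInterval.nonneg _)

theorem le_OPT (k : Fin n) : (1 - S.a k) * S.R k ≤ S.bandit.OPT := by
  have hmem : S.bandit.bp k.castSucc ∈ S.bandit.interval k := by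
    have := S.bandit.bp_strictMono k.castSucc_lt_succ
    unfold BwMJ.interval
    split_ifs
    · exact ⟨le_rfl, this.le⟩
    · exact ⟨le_rfl, this⟩
  have hu : S.bandit.u (S.bandit.bp k.castSucc) = (1 - S.a k) * S.R k := by
    unfold BwMJ.u
    rw [S.bandit.h_eq_of_mem hmem, S.bandit_isBernoulli.mean_eq, S.bandit_encodes.ℓ_eq]
    rfl
  rw [← hu]
  refine le_csSup ⟨1, ?_⟩ ⟨_, rfl⟩
  rintro _ ⟨α, rfl⟩
  unfold BwMJ.u
  rw [S.bandit_isBernoulli.mean_eq]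
  exact mul_le_one₀ (unitInterval.le_one _) (unitInterval.nonneg _) (unitInterval.le_one _)

end StepData

/-! ### The hard instances. -/

/-- The mean of the `i`-th of `n` intervals before perturbation. -/
noncomputable def baseMean (n i : ℕ) : ℝ := 1 / 4 + i / (4 * n)

theorem baseMean_strictMono {n : ℕ} (hn : 0 < n) : StrictMono (baseMean n) := fun i j hij => by
  have : (i : ℝ) < j := by exact_mod_cast hij
  unfold baseMean
  gcongr

theorem baseMean_succ (n i : ℕ) : baseMean n (i + 1) = baseMean n i + 1 / (4 * n) := by
  unfold baseMean
  push_cast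
  ring

theorem quarter_le_baseMean (n i : ℕ) : 1 / 4 ≤ baseMean n i :=
  le_add_of_nonneg_right (by positivity)

theorem baseMean_le_half {n i : ℕ} (hi : i < n) : baseMean n i ≤ 1 / 2 := by
  have hn : (0 : ℝ) < n := by exact_mod_cast (Nat.zero_le i).trans_lt hi
  have hi' : (i : ℝ) ≤ n := by exact_mod_cast hi.le
  have : (i : ℝ) / (4 * n) ≤ 1 / 4 := by
    rw [div_le_iff₀ (by positivity)]
    linarith
  unfold baseMean
  linarith

/-- The data for which the left end points of all intervals have the expected reward `1 / 4`,
except for the `k`-th, whose mean is raised by `ε`. -/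
noncomputable def perturbedData (n k : ℕ) (hn : 0 < n) (ε : ℝ) (hε : 0 ≤ ε)
    (hεn : ε ≤ 1 / (8 * n)) : StepData n where
  -- Independent of `k` and `ε`, so all these instances share their intervals. The value at `n` is
  -- set separately, as the formula would give `1 / 2` there.
  a i := if i < n then 1 - 1 / (4 * baseMean n i) else 1
  R i := baseMean n i + if i = k then ε else 0
  a_zero := by simp [hn, baseMean]
  a_last := by simp
  a_strictMonoOn i hi j hj hij := by
    have hin : i < n := hij.trans_le hj
    have hi0 := quarter_le_baseMean n i
    simp only [hin, if_true]
    split_ifs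
    · have := baseMean_strictMono hn hij
      have : 1 / (4 * baseMean n j) < 1 / (4 * baseMean n i) :=
        one_div_lt_one_div_of_lt (by linarith) (by linarith)
      linarith
    · have : 0 < 1 / (4 * baseMean n i) := by positivity
      linarith
  R_strictMono := strictMono_nat_of_lt_succ fun i => by
    have hn' : (0 : ℝ) < n := by exact_mod_cast hn
    have : (1 : ℝ) / (8 * n) < 1 / (4 * n) :=
      one_div_lt_one_div_of_lt (by linarith) (by linarith)
    rw [baseMean_succ]
    split_ifs <;> linarith
  R_mem i hi := by
    have h1 := quarter_le_baseMean n i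
    have h2 := baseMean_le_half hi
    have hn' : (1 : ℝ) ≤ n := by exact_mod_cast hn
    have h3 : (1 : ℝ) / (8 * n) ≤ 1 / 8 := one_div_le_one_div_of_le (by norm_num) (by linarith)
    constructor <;> split_ifs <;> linarith

section perturbedData

variable {n : ℕ} (k : Fin n) (hn : 0 < n) {ε : ℝ} (hε : 0 ≤ ε) (hεn : ε ≤ 1 / (8 * n))

theorem perturbedData_value (i : Fin n) :
    (1 - (perturbedData n k hn ε hε hεn).a i) * (perturbedData n k hn ε hε hεn).R i =
      1 / 4 + ε / (4 * baseMean n k) * if i = k then 1 else 0 := by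
  have hb : 0 < baseMean n i := by linarith [quarter_le_baseMean n i]
  simp only [perturbedData, i.isLt, if_true, Fin.val_inj]
  split_ifs with h
  · subst h
    field_simp
    ring
  · field_simp
    ring

theorem le_regret_perturbedData {T : ℕ} (π : Policy T) :
    ε / 2 * (T - ∫ H, (perturbedData n k hn ε hε hεn).bandit.count k H
      ∂((perturbedData n k hn ε hε hεn).bandit.historyLaw π T le_rfl)) ≤
      (perturbedData n k hn ε hε hεn).bandit.regret π := by
  have hvalue := perturbedData_value k hn hε hεn
  set S := perturbedData n k hn ε hε hεn
  have := S.bandit_isBernoulli.isProbabilityMeasure_historyLaw π T le_rfl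
  set d := ε / (4 * baseMean n k) with hd
  have hb := quarter_le_baseMean n k
  have hb' := baseMean_le_half k.isLt
  -- The gain `d` at the left end point is at least `ε / 2` because `baseMean n k ≤ 1 / 2`.
  have hd0 : ε / 2 ≤ d := div_le_div_of_nonneg_left hε (by linarith) (by linarith)
  have hint : Integrable (fun H => S.bandit.count k H) (S.bandit.historyLaw π T le_rfl) :=
    BwMJ.integrable_of_abs_le _ (S.bandit.measurable_count k T) (M := T) fun H => by
      rw [abs_of_nonneg (S.bandit.count_nonneg k H)]
      exact S.bandit.count_le k H
  have hcount : ∫ H, S.bandit.count k H ∂(S.bandit.historyLaw π T le_rfl) ≤ T := by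
    have := integral_mono hint (integrable_const (T : ℝ)) (S.bandit.count_le k)
    simpa using this
  have hu : ∫ H, (∑ t : Fin T, S.bandit.u (H t).1) ∂(S.bandit.historyLaw π T le_rfl) ≤
      ∫ H, ((T : ℝ) / 4 + d * S.bandit.count k H) ∂(S.bandit.historyLaw π T le_rfl) := by
    refine integral_mono_of_nonneg
      (ae_of_all _ fun H => Finset.sum_nonneg fun t _ => S.u_nonneg _)
      ((integrable_const _).add (hint.const_mul d)) (ae_of_all _ fun H => ?_)
    calc ∑ t : Fin T, S.bandit.u (H t).1
        ≤ ∑ t : Fin T, (1 / 4 + d * if S.bandit.h (H t).1 = k then 1 else 0) :=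
          Finset.sum_le_sum fun t _ => (S.u_le _).trans_eq (hvalue _)
      _ = (T : ℝ) / 4 + d * S.bandit.count k H := by
          rw [Finset.sum_add_distrib, ← Finset.mul_sum, BwMJ.count]
          simp [div_eq_mul_inv]
  rw [integral_add (integrable_const _) (hint.const_mul d), integral_const_mul] at hu
  simp only [integral_const, probReal_univ, one_smul] at hu
  have hopt := S.le_OPT k
  rw [hvalue, if_pos rfl, mul_one] at hopt
  have hopt' := mul_le_mul_of_nonneg_left hopt (Nat.cast_nonneg (α := ℝ) T)
  have := mul_le_mul_of_nonneg_right hd0 (sub_nonneg.2 hcount)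
  unfold BwMJ.regret
  linarith

end perturbedData

/-! ### Play counts before and after the perturbation. -/

/-- The graph lies below its chord over `[0, 1]`, whose slope is at most `-5 / 8` since `exp (-1) ≤
3 / 8`. -/
theorem exp_neg_le_of_mem_Icc {y : ℝ} (h0 : 0 ≤ y) (h1 : y ≤ 1) :
    Real.exp (-y) ≤ 1 - 5 / 8 * y := by
  have h := convexOn_exp.2 (Set.mem_univ 0) (Set.mem_univ (-1 : ℝ)) (sub_nonneg.2 h1) h0 (by ring)
  simp only [smul_eq_mul, mul_zero, zero_add, mul_neg, mul_one, Real.exp_zero] at h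
  have he : Real.exp (-1) ≤ 3 / 8 := by
    rw [Real.exp_neg, inv_le_comm₀ (Real.exp_pos 1) (by norm_num)]
    linarith [Real.exp_one_gt_d9]
  nlinarith

/-- If the intervals agree and only the mean of the `k`-th one is changed, then an interval that
is rarely played before the change is not played much more often after it. -/
theorem BwMJ.integral_count_le {n T : ℕ} {B B' : BwMJ n} (hbp : B.bp = B'.bp)
    {p p' : Fin n → unitInterval} (hB : B.IsBernoulli p) (hB' : B'.IsBernoulli p') {k : Fin n}
    (hpp : ∀ i, i ≠ k → p' i = p i) (hk : 0 < (p k : ℝ)) (hk1 : (p k : ℝ) < 1)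
    (hk' : 0 < (p' k : ℝ)) (hk1' : (p' k : ℝ) < 1) {K : ℝ} (hK0 : 0 ≤ K)
    (hK : ((p k : ℝ) - p' k) ^ 2 / (p' k * (1 - p' k)) ≤ K) (hT : 0 < T) (π : Policy T) :
    5 / 8 * (∫ H, B'.count k H ∂(B'.historyLaw π T le_rfl)) ≤
      (1 + K * T) * ∫ H, B.count k H ∂(B.historyLaw π T le_rfl) := by
  have := hB.isProbabilityMeasure_historyLaw π T le_rfl
  have := hB'.isProbabilityMeasure_historyLaw π T le_rfl
  have hT' : (0 : ℝ) < T := by exact_mod_cast hT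
  have hh : B'.count k = (B.count k : History T → ℝ) := by
    funext H
    unfold count
    rw [h_eq_h_of_bp_eq hbp]
  have hint : ∀ (μ : Measure (History T)) [IsProbabilityMeasure μ], Integrable (B.count k) μ :=
    fun μ _ => integrable_of_abs_le _ (B.measurable_count k T) (M := T) fun H => by
      rw [abs_of_nonneg (B.count_nonneg k H)]
      exact B.count_le k H
  have hy0 : ∀ H : History T, 0 ≤ B.count k H / T := fun H =>
    div_nonneg (B.count_nonneg k H) hT'.le
  have hy1 : ∀ H : History T, B.count k H / T ≤ 1 := fun H =>
    div_le_one_of_le₀ (B.count_le k H) hT'.le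
  -- The test function is minus the fraction of rounds played in interval `k`; both exponentials are
  -- then linearized.
  have key := exp_integral_le_integral_exp hbp hB hB' hpp hk hk1 hk' hk1' hK0 hK π T le_rfl
    (fun H => -(B.count k H / T)) ((B.measurable_count k T).div_const _).neg 1 fun H => by
      rw [abs_neg, abs_of_nonneg (hy0 H)]
      exact hy1 H
  have hupper : ∫ H, Real.exp (-(B.count k H / T)) ∂(B'.historyLaw π T le_rfl) ≤
      ∫ H, (1 - 5 / 8 * (B.count k H / T)) ∂(B'.historyLaw π T le_rfl) :=
    integral_mono_of_nonneg (ae_of_all _ fun H => (Real.exp_pos _).le)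
      ((integrable_const _).sub (((hint _).div_const _).const_mul _))
      (ae_of_all _ fun H => exp_neg_le_of_mem_Icc (hy0 H) (hy1 H))
  rw [integral_sub (integrable_const _) (((hint _).div_const _).const_mul _), integral_const_mul,
    integral_div] at hupper
  rw [integral_sub (f := fun H => -(B.count k H / T)) ((hint _).div_const _).neg
    ((hint _).const_mul _), integral_neg, integral_div, integral_const_mul] at key
  simp only [integral_const, probReal_univ, one_smul] at hupper
  have hlow := Real.add_one_le_exp (-((∫ H, B.count k H ∂(B.historyLaw π T le_rfl)) / T) -
    K * ∫ H, B.count k H ∂(B.historyLaw π T le_rfl))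
  rw [hh]
  set x := ∫ H, B.count k H ∂(B.historyLaw π T le_rfl)
  set y := ∫ H, B.count k H ∂(B'.historyLaw π T le_rfl)
  have hfin : 5 / 8 * (y / T) ≤ x / T + K * x := by linarith
  have := mul_le_mul_of_nonneg_right hfin hT'.le
  calc 5 / 8 * y = 5 / 8 * (y / T) * T := by field_simp
    _ ≤ (x / T + K * x) * T := this
    _ = (1 + K * T) * x := by field_simp

/-- Pigeonhole: the expected counts add up to `T`. -/
theorem BwMJ.IsBernoulli.exists_integral_count_le {n T : ℕ} {B : BwMJ n}
    {p : Fin n → unitInterval} (hB : B.IsBernoulli p) (hn : 0 < n) (π : Policy T) :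
    ∃ k, ∫ H, B.count k H ∂(B.historyLaw π T le_rfl) ≤ T / n := by
  have := hB.isProbabilityMeasure_historyLaw π T le_rfl
  have hn' : (n : ℝ) ≠ 0 := by exact_mod_cast hn.ne'
  have : Nonempty (Fin n) := ⟨⟨0, hn⟩⟩
  obtain ⟨k, -, hk⟩ := Finset.exists_le_of_sum_le (s := Finset.univ)
    (f := fun k => ∫ H, B.count k H ∂(B.historyLaw π T le_rfl)) (g := fun _ => (T : ℝ) / n)
    Finset.univ_nonempty (by
      rw [← integral_finsetSum]
      · simp only [sum_count]
        simp [mul_div_cancel₀, hn']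
      · exact fun k _ => integrable_of_abs_le _ (B.measurable_count k T) (M := T) fun H => by
          rw [abs_of_nonneg (B.count_nonneg k H)]
          exact B.count_le k H)
  exact ⟨k, hk⟩

/-! ### The lower bound and the choice of `ε`. -/

theorem exists_le_regret {n T : ℕ} (hn : 3 ≤ n) (hT : 0 < T) {ε : ℝ} (hε : 0 ≤ ε)
    (hεn : ε ≤ 1 / (8 * n)) (hεT : 64 * ε ^ 2 * T ≤ n) (π : Policy T) :
    ∃ S : StepData n, ε * T / 8 ≤ S.bandit.regret π := by
  have hn0 : 0 < n := by omega
  have hn' : (3 : ℝ) ≤ n := by exact_mod_cast hn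
  have hT' : (0 : ℝ) < T := by exact_mod_cast hT
  -- The perturbation has size zero, so the index `0` is immaterial.
  let S₀ := perturbedData n 0 hn0 0 le_rfl (by positivity)
  obtain ⟨k, hk⟩ := S₀.bandit_isBernoulli.exists_integral_count_le hn0 π
  let S := perturbedData n k hn0 ε hε hεn
  have hb := quarter_le_baseMean n k
  have hb' := baseMean_le_half k.isLt
  have hε8 : ε ≤ 1 / 8 := hεn.trans (one_div_le_one_div_of_le (by norm_num) (by linarith))
  have hp : (S₀.prob k : ℝ) = baseMean n k := by simp [S₀, StepData.prob, perturbedData]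
  have hq : (S.prob k : ℝ) = baseMean n k + ε := by simp [S, StepData.prob, perturbedData]
  -- `16 / 3` is the inverse of `3 / 16`, the least Bernoulli variance for a parameter in `[1 / 4, 5
  -- / 8]`.
  have hcount := BwMJ.integral_count_le (B := S₀.bandit) (B' := S.bandit) rfl
    S₀.bandit_isBernoulli S.bandit_isBernoulli (k := k) (K := 16 / 3 * ε ^ 2)
    (fun i hi => Subtype.ext (by
      simp [S, S₀, StepData.prob, perturbedData, Fin.val_inj, hi]))
    (by rw [hp]; linarith) (by rw [hp]; linarith) (by rw [hq]; linarith) (by rw [hq]; linarith)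
    (by positivity)
    (by
      rw [hp, hq, div_le_iff₀ (by apply mul_pos <;> linarith)]
      have : 3 / 16 ≤ (baseMean n k + ε) * (1 - (baseMean n k + ε)) := by nlinarith
      nlinarith [mul_le_mul_of_nonneg_left this (sq_nonneg ε)]) hT π
  refine ⟨S, le_trans ?_ (le_regret_perturbedData k hn0 hε hεn π)⟩
  -- `5 / 12 = 1 / 3 + 1 / 12`: the first term uses `n ≥ 3`, the second the bound on `ε² T`. Hence
  -- interval `k` gets at most `2 / 3` of the rounds in expectation.
  have hbound : (1 + 16 / 3 * ε ^ 2 * T) * ((T : ℝ) / n) ≤ 5 / 12 * T := by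
    have h1 : (T : ℝ) / n ≤ T / 3 := div_le_div_of_nonneg_left hT'.le (by norm_num) hn'
    have h2 : 16 / 3 * ε ^ 2 * T * ((T : ℝ) / n) ≤ n / 12 * (T / n) :=
      mul_le_mul_of_nonneg_right (by linarith) (by positivity)
    have h3 : (n : ℝ) / 12 * (T / n) = T / 12 := by
      field_simp
    linarith
  have hmul := mul_le_mul_of_nonneg_left hk
    (show 0 ≤ 1 + 16 / 3 * ε ^ 2 * (T : ℝ) by positivity)
  have hle : (T : ℝ) / 4 ≤ T - ∫ H, S.bandit.count k H ∂(S.bandit.historyLaw π T le_rfl) := by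
    linarith
  have := mul_le_mul_of_nonneg_left hle (div_nonneg hε (by norm_num : (0 : ℝ) ≤ 2))
  linarith

theorem mainTheorem2 :
    ∃ C : ℝ, 0 < C ∧ ∀ n T : ℕ, 3 ≤ n → (n : ℝ) ≤ (T : ℝ) ^ ((1 : ℝ) / 3) →
      ∀ π : Policy T, ∃ (m : ℕ) (P : PrincipalAgent n m) (B : BwMJ n),
        P.Standing ∧ B.Encodes P ∧ C * Real.sqrt ((n : ℝ) * (T : ℝ)) ≤ B.regret π := by
  refine ⟨1 / 64, by norm_num, fun n T hn hnT π => ?_⟩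
  have hn' : (0 : ℝ) < n := by exact_mod_cast (by omega : 0 < n)
  have hcube : (n : ℝ) ^ 3 ≤ T := by
    calc (n : ℝ) ^ 3 ≤ ((T : ℝ) ^ ((1 : ℝ) / 3)) ^ 3 := by gcongr
      _ = (T : ℝ) := by
        rw [← Real.rpow_natCast, ← Real.rpow_mul (Nat.cast_nonneg T)]
        norm_num
  have hT' : (0 : ℝ) < T := (pow_pos hn' 3).trans_le hcube
  set s := Real.sqrt ((n : ℝ) / T) with hs
  have hs2 : s ^ 2 = (n : ℝ) / T := Real.sq_sqrt (by positivity)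
  have hsn : s ≤ 1 / n := by
    refine Real.sqrt_le_iff.2 ⟨by positivity, ?_⟩
    rw [div_pow, one_pow, div_le_div_iff₀ hT' (by positivity)]
    linarith
  -- `ε = s / 8` gives equality in `64 ε² T ≤ n`; the factors `1 / 8` here and in `exists_le_regret`
  -- make up `C = 1 / 64`.
  obtain ⟨S, hS⟩ := exists_le_regret hn (by exact_mod_cast hT' : 0 < T) (ε := s / 8)
    (by positivity) (by rw [← div_div, div_right_comm]; gcongr)
    (by rw [div_pow, hs2]; apply le_of_eq; field_simp; norm_num) π
  refine ⟨2, S.principalAgent, S.bandit, S.principalAgent_standing, S.bandit_encodes, ?_⟩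
  have hsqrt : Real.sqrt ((n : ℝ) * T) = s * T := by
    rw [hs, ← Real.sqrt_sq hT'.le, ← Real.sqrt_mul (by positivity), Real.sqrt_sq hT'.le]
    congr 1
    field_simp
  rw [hsqrt]
  linarith
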